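/- Let $n$ be a natural number, let $f:\mathbb{R}^n\to[0,\infty)$ be Lebesgue integrable, and let $\mu$ be a measure on $\mathbb{R}^n$ with $\mathrm{d}\mu(x)=\phi(x)\,\mathrm{d}x$, where $\phi:\mathbb{R}^n\to[0,\infty)$ is (Lebesgue measurable and) radially decreasing, i.e. $\phi(tx)\ge\phi(x)$ for all $x\in\mathbb{R}^n$ and $t\in[0,1]$. Write $S_{\ge t}(f)=\{x\in\mathbb{R}^n: f(x)\ge t\}$ and, for $K\subset\mathbb{R}^n$ convex of finite volume, let \[ \overline{\mu}(K)=\frac{1}{\mathrm{vol}(K)}\int_K\mu(-y+K)\,\mathrm{d}y , \] with $\overline\mu(K)=0$ if $\mathrm{vol}(K)=0$. (a) Suppose that $f$ is quasi-concave, i.e. $f((1-\lambda)x+\lambda y)\ge\min\{f(x),f(y)\}$ for all $x,y\in\mathbb{R}^n$ and $\lambda\in(0,1)$, and let $\Delta_{-\infty}f(z)=\sup_{z=x-y}\min\{f(x),f(y)\}\in[0,\infty]$. Then $\Delta_{-\infty}f$ is Lebesgue measurable, \[ \int_{\mathbb{R}^n}\Delta_{-\infty}f(x)\,\mathrm{d}\mu(x)\le\binom{2n}{n}\int_0^\infty\min\Bigl\{\overline{\mu}\bigl(S_{\ge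 t}(f)\bigr),\overline{\mu}\bigl(-S_{\ge t}(f)\bigr)\Bigr\}\,\mathrm{d}t , \] and, for the Lebesgue measure, \[ \int_{\mathbb{R}^n}\Delta_{-\infty}f(x)\,\mathrm{d}x\le\binom{2n}{n}\int_{\mathbb{R}^n}f(x)\,\mathrm{d}x . \] (b) Let $p\in(-\infty,0)$ and suppose that $f$ is $p$-concave, i.e. $f((1-\lambda)x+\lambda y)\ge\bigl((1-\lambda)f(x)^p+\lambda f(y)^p\bigr)^{1/p}$ for all $\lambda\in(0,1)$ and all $x,y\in\mathbb{R}^n$ with $f(x)f(y)>0$. Let $\Delta_pf(z)=\sup_{z=x-y}\bigl(f(x)^p+f(y)^p\bigr)^{1/p}\in[0,\infty]$, where the expression is read as $0$ if $f(x)f(y)=0$. Then $\Delta_pf$ is Lebesgue measurable, and both inequalities of (a) hold with $\Delta_pf$ in place of $\Delta_{-\infty}f$. -/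

import Mathlib

open MeasureTheory
open scoped NNReal ENNReal Pointwise

/-- The Euclidean space `ℝⁿ`. -/
abbrev Euc (n : ℕ) : Type := EuclideanSpace ℝ (Fin n)

/-- `φ` is radially decreasing: `φ(t x) ≥ φ(x)` for all `x` and all `t ∈ [0,1]`. -/
def RadiallyDecreasing {n : ℕ} (φ : Euc n → ℝ≥0) : Prop :=
  ∀ x : Euc n, ∀ t ∈ Set.Icc (0 : ℝ) 1, φ x ≤ φ (t • x)

/-- The measure with density `φ` with respect to Lebesgue measure. -/
noncomputable def densityMeasure {n : ℕ} (φ : Euc n → ℝ≥0) : Measure (Euc n) :=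
  (volume : Measure (Euc n)).withDensity (fun x => (φ x : ℝ≥0∞))

/-- The superlevel set `{x | f x ≥ t}`. -/
def superlevel {n : ℕ} (f : Euc n → ℝ≥0) (t : ℝ) : Set (Euc n) :=
  {x | t ≤ (f x : ℝ)}

/-- The translated-average `(1 / vol K) ∫_K μ(-y + K) dy` of `μ` on the set `K`.
It equals `0` if `vol K = 0`, because then the integral over `K` vanishes. -/
noncomputable def translatedAverage {n : ℕ} (μ : Measure (Euc n)) (K : Set (Euc n)) : ℝ≥0∞ :=
  (volume K)⁻¹ * ∫⁻ y in K, μ ((-y) +ᵥ K)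

/-- The `(-∞)`-difference `z ↦ sup_{z = x - y} min {f x, f y}`, with values in `[0, ∞]`
(`f` may be unbounded). -/
noncomputable def minDifference {n : ℕ} (f : Euc n → ℝ≥0) (z : Euc n) : ℝ≥0∞ :=
  ⨆ (x : Euc n) (y : Euc n) (_ : z = x - y), min (f x : ℝ≥0∞) (f y : ℝ≥0∞)

/-- The `p`-difference `z ↦ sup_{z = x - y} (f(x)^p + f(y)^p)^(1/p)`, with values in `[0, ∞]`.
For `p < 0` the powers in `[0, ∞]` satisfy `0 ^ p = ∞` and `∞ ^ (1/p) = 0`, so that the expression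
is `0` as soon as `f x = 0` or `f y = 0`. -/
noncomputable def pDifference {n : ℕ} (p : ℝ) (f : Euc n → ℝ≥0) (z : Euc n) : ℝ≥0∞ :=
  ⨆ (x : Euc n) (y : Euc n) (_ : z = x - y),
    ((f x : ℝ≥0∞) ^ p + (f y : ℝ≥0∞) ^ p) ^ (1 / p)

/-- The `p`-mean, `p` real, of two non-negative numbers with weights `1 - s` and `s`. -/
noncomputable def pMean (p a b s : ℝ) : ℝ :=
  if a * b = 0 then 0
  else if p = 0 then a ^ (1 - s) * b ^ s
  else ((1 - s) * a ^ p + s * b ^ p) ^ (1 / p)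

/-- `p`-concavity, `p` real. -/
def IsPConcave {n : ℕ} (p : ℝ) (f : Euc n → ℝ≥0) : Prop :=
  ∀ x y : Euc n, ∀ s ∈ Set.Ioo (0 : ℝ) 1,
    pMean p (f x : ℝ) (f y : ℝ) s ≤ (f ((1 - s) • x + s • y) : ℝ)

/-! Everything reduces to a Rogers–Shephard inequality `μ(K - K) ≤ C(2n,n) · μ̄(K)` for convex `K`
of finite volume (`densityMeasure_sub_le`). By Tonelli, `∫_K μ(-y + K) dy = ∫ vol(K ∩ (K - z))
dμ(z)`. If `z = r(a - b)` with `a, b ∈ K`, then `K ∩ (K - z)` contains `(1 - r)K + rb`, of volume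
`(1 - r)^n vol K`. Writing `(1 - g)^n` as `∫_g^1 n(1 - r)^(n-1) dr`, with `g` the gauge of `z` in `K
- K`, and swapping integrals leaves `∫_0^1 n(1 - r)^(n-1) μ(r(K - K)) dr`. Radial decrease gives
`μ(rD) ≥ r^n μ(D)`, and the remaining Beta integral is `1 / C(2n,n)`. For functions, `{Δf > t}` lies
in `S - S` with `S` the superlevel set at `t`; the layer-cake formula integrates the set inequality
over `t`. The case of `p < 0` follows since `Δ_p f ≤ Δ_{-∞} f` and `p`-concavity implies
quasi-concavity. Measurability holds because the strict superlevel sets are convex. -/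

/-! ### The Beta integral -/

open Nat in
theorem integral_pow_mul_one_sub_pow (a b : ℕ) :
    ∫ x in (0 : ℝ)..1, x ^ a * (1 - x) ^ b = (a ! * b ! : ℝ) / (a + b + 1)! := by
  induction b generalizing a with
  | zero =>
    simp [integral_pow, Nat.factorial_succ]
    field_simp
  | succ b ih =>
    have hu : ∀ x ∈ Set.uIcc (0 : ℝ) 1, HasDerivAt (fun x : ℝ => (1 - x) ^ (b + 1))
        (-((b + 1) * (1 - x) ^ b)) x := fun x _ => by
      simpa using ((hasDerivAt_id' x).const_sub 1).fun_pow (b + 1)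
    have hv : ∀ x ∈ Set.uIcc (0 : ℝ) 1, HasDerivAt (fun x : ℝ => x ^ (a + 1) / (a + 1))
        (x ^ a) x := fun x _ => by
      have ha : (a : ℝ) + 1 ≠ 0 := by positivity
      simpa [ha] using ((hasDerivAt_id' x).fun_pow (a + 1)).div_const ((a : ℝ) + 1)
    have key := intervalIntegral.integral_mul_deriv_eq_deriv_mul hu hv
      (Continuous.intervalIntegrable (by fun_prop) _ _)
      (Continuous.intervalIntegrable (by fun_prop) _ _)
    have e1 : ∀ x : ℝ, x ^ a * (1 - x) ^ (b + 1) = (1 - x) ^ (b + 1) * x ^ a := fun x => mul_comm _ _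
    have e2 : ∀ x : ℝ, -((b + 1) * (1 - x) ^ b) * (x ^ (a + 1) / (a + 1)) =
        (-((b + 1) / (a + 1)) : ℝ) * (x ^ (a + 1) * (1 - x) ^ b) := fun x => by ring
    simp_rw [e1, key, e2, intervalIntegral.integral_const_mul, ih]
    have h3 : a + 1 + b + 1 = a + (b + 1) + 1 := by omega
    rw [h3, Nat.factorial_succ a, Nat.factorial_succ b]
    have : (a : ℝ) + 1 ≠ 0 := by positivity
    push_cast
    simp
    field_simp

theorem centralBinom_mul_lintegral_pow_mul_one_sub_pow {n : ℕ} (hn : n ≠ 0) :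
    ((2 * n).choose n : ℝ≥0∞) * ∫⁻ r in Set.Ioo (0 : ℝ) 1,
      ENNReal.ofReal (n * (1 - r) ^ (n - 1)) * ENNReal.ofReal (r ^ n) = 1 := by
  have h : ∫⁻ r in Set.Ioo (0 : ℝ) 1,
      ENNReal.ofReal (n * (1 - r) ^ (n - 1)) * ENNReal.ofReal (r ^ n) =
      ENNReal.ofReal (n * ∫ x in (0 : ℝ)..1, x ^ n * (1 - x) ^ (n - 1)) := by
    rw [← intervalIntegral.integral_const_mul, intervalIntegral.integral_of_le zero_le_one,
      integral_Ioc_eq_integral_Ioo, ofReal_integral_eq_lintegral_ofReal]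
    · refine setLIntegral_congr_fun measurableSet_Ioo fun r hr => ?_
      have : 0 ≤ 1 - r := by linarith [hr.2]
      rw [← ENNReal.ofReal_mul (by positivity)]
      ring_nf
    · exact (Continuous.integrableOn_Icc (by fun_prop)).mono_set Set.Ioo_subset_Icc_self
    · refine (ae_restrict_iff' measurableSet_Ioo).2 (.of_forall fun r hr => ?_)
      have : 0 ≤ 1 - r := by linarith [hr.2]
      have := hr.1
      simp only [Pi.zero_apply]
      positivity
  obtain ⟨m, rfl⟩ := Nat.exists_eq_succ_of_ne_zero hn
  rw [h, integral_pow_mul_one_sub_pow, ← ENNReal.ofReal_natCast, ← ENNReal.ofReal_mul (by positivity),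
    Nat.cast_choose ℝ (by omega), ← ENNReal.ofReal_one]
  congr 1
  have e1 : 2 * m.succ - m.succ = m + 1 := by omega
  have e2 : m.succ + (m.succ - 1) + 1 = 2 * m.succ := by simp only [Nat.succ_eq_add_one]; omega
  rw [e1, e2]
  simp only [Nat.succ_eq_add_one, Nat.add_sub_cancel]
  have h1 := Nat.factorial_ne_zero (2 * (m + 1))
  have h2 := Nat.factorial_ne_zero m
  rw [Nat.factorial_succ m]
  push_cast
  field_simp

/-! ### Rogers–Shephard for open convex sets -/

/-- Substitute `z = r • x`: the Jacobian is `r ^ n` and the density can only grow towards the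
origin. This is where radial decrease enters. -/
theorem ofReal_pow_mul_densityMeasure_le {n : ℕ} {φ : Euc n → ℝ≥0} (hφ : RadiallyDecreasing φ)
    (D : Set (Euc n)) {r : ℝ} (h0 : 0 < r) (h1 : r ≤ 1) :
    ENNReal.ofReal (r ^ n) * densityMeasure φ D ≤ densityMeasure φ {z | r⁻¹ • z ∈ D} := by
  have he : MeasurableEmbedding (fun x : Euc n => r • x) := measurableEmbedding_const_smul₀ h0.ne'
  have hv : (volume : Measure (Euc n)) =
      ENNReal.ofReal (r ^ n) • (volume : Measure (Euc n)).map (fun x => r • x) := by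
    have := Measure.map_addHaar_smul (volume : Measure (Euc n)) h0.ne'
    simp only [finrank_euclideanSpace, Fintype.card_fin] at this
    rw [show (fun x : Euc n => r • x) = (r • ·) from rfl, this, smul_smul,
      ← ENNReal.ofReal_mul (by positivity), abs_of_pos (by positivity),
      mul_inv_cancel₀ (by positivity), ENNReal.ofReal_one, one_smul]
  rw [densityMeasure, withDensity_apply', withDensity_apply']
  conv_rhs => rw [hv, Measure.restrict_smul, lintegral_smul_measure, he.restrict_map,
    he.lintegral_map]
  have hp : (fun x : Euc n => r • x) ⁻¹' {z | r⁻¹ • z ∈ D} = D := by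
    ext x; simp [smul_smul, h0.ne']
  rw [hp, smul_eq_mul]
  gcongr with x
  exact hφ x r ⟨h0.le, h1⟩

/-- With `w = a - b`, the homothetic copy `(1 - r)K + rb` lies in `K` by convexity, and its
translate by `z` is `(1 - r)K + ra`, again in `K`. -/
theorem pow_mul_volume_le_of_mem_smul_sub {n : ℕ} {K : Set (Euc n)} (hK : Convex ℝ K) {r : ℝ}
    (h0 : 0 ≤ r) (h1 : r ≤ 1) {w z : Euc n} (hw : w ∈ K - K) (hz : z = r • w) :
    ENNReal.ofReal ((1 - r) ^ n) * volume K ≤ volume (K ∩ {y | y + z ∈ K}) := by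
  obtain ⟨a, ha, b, hb, rfl⟩ := hw
  have hs : (1 - r) • K + {r • b} ⊆ K ∩ {y | y + z ∈ K} := by
    rintro _ ⟨_, ⟨k, hk, rfl⟩, _, rfl, rfl⟩
    refine ⟨hK hk hb (by linarith) h0 (by ring), ?_⟩
    have := hK hk ha (by linarith) h0 (by ring : (1 - r) + r = 1)
    simp only [Set.mem_ofPred_eq, hz]
    convert this using 1
    module
  refine le_trans (le_of_eq ?_) (measure_mono hs)
  rw [Set.add_singleton, Set.image_add_right, measure_preimage_add_right,
    Measure.addHaar_smul_of_nonneg _ (by linarith)]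
  simp

/-- The measure `n (1 - r) ^ (n - 1) dr` on `(0, 1)`. -/
noncomputable def coneMeasure (n : ℕ) : Measure ℝ :=
  (volume.restrict (Set.Ioo (0 : ℝ) 1)).withDensity fun r => ENNReal.ofReal (n * (1 - r) ^ (n - 1))

theorem coneMeasure_le {n : ℕ} (hn : n ≠ 0) {g : ℝ} (hg1 : g ≤ 1) {A : Set ℝ}
    (hA : A ∩ Set.Ioo 0 1 ⊆ Set.Ici g) :
    coneMeasure n A ≤ ENNReal.ofReal ((1 - g) ^ n) := by
  have hi : ∫ r in g..1, (n * (1 - r) ^ (n - 1) : ℝ) = (1 - g) ^ n := by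
    rw [intervalIntegral.integral_comp_sub_left (fun u : ℝ => (n : ℝ) * u ^ (n - 1)) 1,
      intervalIntegral.integral_const_mul, integral_pow]
    obtain ⟨m, rfl⟩ := Nat.exists_eq_succ_of_ne_zero hn
    simp
    field_simp
  rw [coneMeasure, withDensity_apply', Measure.restrict_restrict' measurableSet_Ioo, ← hi,
    intervalIntegral.integral_of_le hg1, ← integral_Icc_eq_integral_Ioc,
    ofReal_integral_eq_lintegral_ofReal]
  · exact lintegral_mono_set fun r hr => ⟨hA hr, hr.2.2.le⟩
  · exact Continuous.integrableOn_Icc (by fun_prop)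
  · refine (ae_restrict_iff' measurableSet_Icc).2 (.of_forall fun r hr => ?_)
    have : 0 ≤ 1 - r := by linarith [hr.2]
    simp only [Pi.zero_apply]
    positivity

/-- The infimum of the admissible `r` need not be attained, so the homothety bound is applied along
a sequence tending to it and passed to the limit. -/
theorem coneMeasure_mul_volume_le {n : ℕ} (hn : n ≠ 0) {K : Set (Euc n)} (hK : Convex ℝ K)
    (hfin : volume K ≠ ∞) (z : Euc n) :
    coneMeasure n {r | r⁻¹ • z ∈ K - K} * volume K ≤ volume (K ∩ {y | y + z ∈ K}) := by
  set A : Set ℝ := {r | r⁻¹ • z ∈ K - K} ∩ Set.Ioo 0 1 with hA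
  have hb : BddBelow A := ⟨0, fun r hr => hr.2.1.le⟩
  rcases A.eq_empty_or_nonempty with he | hne
  · have := coneMeasure_le hn le_rfl (A := {r | r⁻¹ • z ∈ K - K}) (by simp [← hA, he])
    simp only [sub_self, ne_eq, hn, not_false_eq_true, zero_pow, ENNReal.ofReal_zero,
      nonpos_iff_eq_zero] at this
    simp [this]
  · have hg1 : sInf A ≤ 1 := by
      obtain ⟨r, hr⟩ := hne
      exact (csInf_le hb hr).trans hr.2.2.le
    refine (mul_le_mul_left (coneMeasure_le hn hg1 (A := {r | r⁻¹ • z ∈ K - K})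
      fun r hr => csInf_le hb hr) _).trans ?_
    obtain ⟨u, -, hu, huA⟩ := exists_seq_tendsto_sInf hne hb
    have hc : Continuous fun g : ℝ => ENNReal.ofReal ((1 - g) ^ n) * volume K :=
      (ENNReal.continuous_mul_const hfin).comp (ENNReal.continuous_ofReal.comp (by fun_prop))
    refine le_of_tendsto ((hc.tendsto _).comp hu) (.of_forall fun k => ?_)
    have hk := huA k
    exact pow_mul_volume_le_of_mem_smul_sub hK hk.2.1.le hk.2.2.le hk.1
      (by rw [smul_smul, mul_inv_cancel₀ hk.2.1.ne', one_smul])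

theorem lintegral_measure_translate {n : ℕ} (μ : Measure (Euc n)) [SFinite μ] {K : Set (Euc n)}
    (hK : MeasurableSet K) :
    ∫⁻ y in K, μ ((-y) +ᵥ K) = ∫⁻ z, volume (K ∩ {y | y + z ∈ K}) ∂μ := by
  have hS : MeasurableSet {q : Euc n × Euc n | q.1 + q.2 ∈ K} :=
    (measurable_fst.add measurable_snd) hK
  have h1 := Measure.prod_apply (μ := volume.restrict K) (ν := μ) hS
  rw [Measure.prod_apply_symm hS] at h1
  convert h1.symm using 2
  · ext y
    congr 1
    ext z
    simp [Set.mem_vadd_set_iff_neg_vadd_mem]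
  · ext z
    rw [Measure.restrict_apply' hK, Set.inter_comm]
    rfl

theorem volume_mul_densityMeasure_sub_le_of_isOpen {n : ℕ} {φ : Euc n → ℝ≥0}
    (hφ : RadiallyDecreasing φ) {K : Set (Euc n)} (hK : Convex ℝ K) (hKo : IsOpen K)
    (hfin : volume K ≠ ∞) :
    volume K * densityMeasure φ (K - K) ≤
      ((2 * n).choose n : ℝ≥0∞) * ∫⁻ y in K, densityMeasure φ ((-y) +ᵥ K) := by
  have : SFinite (densityMeasure φ) := by unfold densityMeasure; infer_instance
  have : SFinite (coneMeasure n) := by unfold coneMeasure; infer_instance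
  have hD : MeasurableSet (K - K) := hKo.sub_right.measurableSet
  rw [lintegral_measure_translate _ hKo.measurableSet]
  -- In dimension `0` the cone measure vanishes; the homothety bound with `r = 1` suffices, as `0 ^
  -- 0 = 1`.
  rcases eq_or_ne n 0 with rfl | hn
  · simp only [mul_zero, Nat.choose_self, Nat.cast_one, one_mul]
    rw [← setLIntegral_const]
    refine (setLIntegral_mono' hD fun z hz => ?_).trans (setLIntegral_le_lintegral _ _)
    simpa using pow_mul_volume_le_of_mem_smul_sub hK zero_le_one le_rfl hz (one_smul ℝ z).symm
  have hS : MeasurableSet {q : Euc n × ℝ | q.2⁻¹ • q.1 ∈ K - K} :=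
    (measurable_snd.inv.smul measurable_fst) hD
  have hswap := Measure.prod_apply (μ := densityMeasure φ) (ν := coneMeasure n) hS
  rw [Measure.prod_apply_symm hS] at hswap
  have hlow : (∫⁻ r in Set.Ioo (0 : ℝ) 1, ENNReal.ofReal (n * (1 - r) ^ (n - 1)) *
      ENNReal.ofReal (r ^ n)) * densityMeasure φ (K - K) ≤
      ∫⁻ r, densityMeasure φ {z | r⁻¹ • z ∈ K - K} ∂(coneMeasure n) := by
    rw [coneMeasure, lintegral_withDensity_eq_lintegral_mul_non_measurable _ (by fun_prop)
      (.of_forall fun r => ENNReal.ofReal_lt_top), ← lintegral_mul_const _ (by fun_prop)]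
    refine setLIntegral_mono' measurableSet_Ioo fun r hr => ?_
    rw [Pi.mul_apply, mul_assoc]
    gcongr
    exact ofReal_pow_mul_densityMeasure_le hφ _ hr.1 hr.2.le
  calc volume K * densityMeasure φ (K - K)
      = ((2 * n).choose n : ℝ≥0∞) * (((∫⁻ r in Set.Ioo (0 : ℝ) 1,
        ENNReal.ofReal (n * (1 - r) ^ (n - 1)) * ENNReal.ofReal (r ^ n)) *
          densityMeasure φ (K - K)) * volume K) := by
        rw [← mul_assoc, ← mul_assoc, centralBinom_mul_lintegral_pow_mul_one_sub_pow hn, one_mul,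
          mul_comm]
    _ ≤ ((2 * n).choose n : ℝ≥0∞) *
        ((∫⁻ z, coneMeasure n {r | r⁻¹ • z ∈ K - K} ∂(densityMeasure φ)) * volume K) := by
        gcongr
        exact hlow.trans hswap.le
    _ ≤ _ := by
        gcongr
        rw [← lintegral_mul_const' _ _ hfin]
        exact lintegral_mono fun z => coneMeasure_mul_volume_le hn hK hfin z

/-! ### Rogers–Shephard for arbitrary convex sets -/

theorem densityMeasure_absolutelyContinuous {n : ℕ} (φ : Euc n → ℝ≥0) :
    densityMeasure φ ≪ (volume : Measure (Euc n)) :=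
  withDensity_absolutelyContinuous _ _

/-- A null convex set has empty interior, hence spans a proper affine subspace, whose direction
contains all differences. -/
theorem volume_sub_eq_zero {n : ℕ} {K : Set (Euc n)} (hK : Convex ℝ K) (h0 : volume K = 0) :
    volume (K - K) = 0 := by
  rcases K.eq_empty_or_nonempty with rfl | hne
  · simp
  have hi : interior K = ∅ := by
    by_contra h
    have := isOpen_interior.measure_pos (volume : Measure (Euc n)) (Set.nonempty_iff_ne_empty.2 h)
    exact this.ne' (measure_mono_null interior_subset h0)
  have hspan : affineSpan ℝ K ≠ ⊤ := fun h => by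
    have := hK.interior_nonempty_iff_affineSpan_eq_top.2 h
    simp [hi] at this
  have hdir : (affineSpan ℝ K).direction ≠ ⊤ := fun h => hspan
    ((AffineSubspace.direction_eq_top_iff_of_nonempty ((affineSpan_nonempty ℝ).2 hne)).1 h)
  refine measure_mono_null ?_ (Measure.addHaar_submodule volume _ hdir)
  rintro _ ⟨a, ha, b, hb, rfl⟩
  exact AffineSubspace.vsub_mem_direction (subset_affineSpan ℝ K ha) (subset_affineSpan ℝ K hb)

theorem densityMeasure_sub_le {n : ℕ} {φ : Euc n → ℝ≥0} (hφ : RadiallyDecreasing φ)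
    {K : Set (Euc n)} (hK : Convex ℝ K) (hfin : volume K ≠ ∞) :
    densityMeasure φ (K - K) ≤
      ((2 * n).choose n : ℝ≥0∞) * translatedAverage (densityMeasure φ) K := by
  rcases eq_or_ne (volume K) 0 with h0 | h0
  · rw [densityMeasure_absolutelyContinuous φ (volume_sub_eq_zero hK h0)]
    exact zero_le
  have hvol : volume (interior K) = volume K := by
    refine le_antisymm (measure_mono interior_subset) ?_
    refine (measure_mono (t := interior K ∪ frontier K) ?_).trans ((measure_union_le _ _).trans ?_)
    · rw [← closure_eq_interior_union_frontier]; exact subset_closure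
    · rw [hK.addHaar_frontier volume, add_zero]
  have hne : (interior K).Nonempty := by
    by_contra h
    rw [Set.not_nonempty_iff_eq_empty] at h
    rw [← hvol, h, measure_empty] at h0
    exact h0 rfl
  -- `K - K` exceeds the open convex set `int K - int K` at most by points of its frontier, which is
  -- null.
  have hsub : densityMeasure φ (K - K) ≤ densityMeasure φ (interior K - interior K) := by
    have hc : K - K ⊆ closure (interior K - interior K) := by
      have hcl := hK.closure_interior_eq_closure_of_nonempty_interior hne
      rintro _ ⟨a, ha, b, hb, rfl⟩
      exact map_mem_closure₂ continuous_sub (hcl ▸ subset_closure ha) (hcl ▸ subset_closure hb)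
        fun a ha b hb => Set.sub_mem_sub ha hb
    refine (measure_mono (hc.trans (closure_eq_interior_union_frontier _).le)).trans
      ((measure_union_le _ _).trans ?_)
    rw [densityMeasure_absolutelyContinuous φ
      ((hK.interior.sub hK.interior).addHaar_frontier volume), add_zero]
    exact measure_mono interior_subset
  have key := volume_mul_densityMeasure_sub_le_of_isOpen hφ hK.interior isOpen_interior
    (hvol ▸ hfin)
  rw [hvol] at key
  have hint : ∫⁻ y in interior K, densityMeasure φ ((-y) +ᵥ interior K) ≤
      ∫⁻ y in K, densityMeasure φ ((-y) +ᵥ K) :=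
    (lintegral_mono fun y => measure_mono (Set.vadd_set_mono interior_subset)).trans
      (lintegral_mono_set interior_subset)
  rw [translatedAverage, mul_left_comm]
  calc densityMeasure φ (K - K) ≤ densityMeasure φ (interior K - interior K) := hsub
    _ = (volume K)⁻¹ * (volume K * densityMeasure φ (interior K - interior K)) := by
        rw [← mul_assoc, ENNReal.inv_mul_cancel h0 hfin, one_mul]
    _ ≤ (volume K)⁻¹ * (((2 * n).choose n : ℝ≥0∞) * ∫⁻ y in K, densityMeasure φ ((-y) +ᵥ K)) :=
        mul_le_mul_right (key.trans (mul_le_mul_right hint _)) _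

/-! ### Layer cake and quasi-concave functions -/

theorem lintegral_eq_lintegral_measure_lt {α : Type*} [MeasurableSpace α] (μ : Measure α)
    [SFinite μ] {F : α → ℝ≥0∞} (hF : AEMeasurable F μ) :
    ∫⁻ z, F z ∂μ = ∫⁻ t in Set.Ioi (0 : ℝ), μ {z | ENNReal.ofReal t < F z} := by
  have hG := hF.measurable_mk
  set G := hF.mk F with hGdef
  have hae : F =ᵐ[μ] G := hF.ae_eq_mk
  have hS : MeasurableSet {q : α × ℝ | ENNReal.ofReal q.2 < G q.1} :=
    measurableSet_lt (ENNReal.measurable_ofReal.comp measurable_snd) (hG.comp measurable_fst)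
  have h1 := Measure.prod_apply (μ := μ) (ν := volume.restrict (Set.Ioi (0 : ℝ))) hS
  rw [Measure.prod_apply_symm hS] at h1
  have h2 : ∀ z, G z = (volume.restrict (Set.Ioi (0 : ℝ)))
      (Prod.mk z ⁻¹' {q : α × ℝ | ENNReal.ofReal q.2 < G q.1}) := fun z => by
    rw [Measure.restrict_apply' measurableSet_Ioi]
    rcases eq_or_ne (G z) ∞ with h | h
    · have : Prod.mk z ⁻¹' {q : α × ℝ | ENNReal.ofReal q.2 < G q.1} ∩ Set.Ioi 0 = Set.Ioi 0 := by
        ext t; simp [h]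
      rw [this, Real.volume_Ioi, h]
    · have : Prod.mk z ⁻¹' {q : α × ℝ | ENNReal.ofReal q.2 < G q.1} ∩ Set.Ioi 0 =
          Set.Ioo 0 (G z).toReal := by
        ext t
        simp only [Set.mem_inter_iff, Set.mem_preimage, Set.mem_ofPred_eq, Set.mem_Ioi, Set.mem_Ioo]
        rw [and_comm]
        exact and_congr_right fun ht => ENNReal.ofReal_lt_iff_lt_toReal (le_of_lt ht) h
      rw [this, Real.volume_Ioo, sub_zero, ENNReal.ofReal_toReal h]
  rw [lintegral_congr_ae hae, lintegral_congr h2, ← h1]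
  refine lintegral_congr fun t => measure_congr (Filter.eventuallyEq_set.2 ?_)
  filter_upwards [hae] with z hz
  simp [hz]

theorem aemeasurable_of_convex_lt {n : ℕ} {F : Euc n → ℝ≥0∞}
    (h : ∀ c, Convex ℝ {z | c < F z}) : AEMeasurable F (volume : Measure (Euc n)) := by
  have : NullMeasurable F (volume : Measure (Euc n)) :=
    measurable_of_Ioi (α := ℝ≥0∞) (δ := NullMeasurableSpace (Euc n) volume) fun c =>
      (h c).nullMeasurableSet volume
  exact this.aemeasurable

theorem setOf_lt_minDifference_subset {n : ℕ} (f : Euc n → ℝ≥0) {t : ℝ} (ht : 0 ≤ t) :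
    {z | ENNReal.ofReal t < minDifference f z} ⊆ superlevel f t - superlevel f t := by
  intro z hz
  simp only [Set.mem_ofPred_eq, minDifference, lt_iSup_iff] at hz
  obtain ⟨x, y, rfl, h⟩ := hz
  have aux : ∀ w, ENNReal.ofReal t < (f w : ℝ≥0∞) → w ∈ superlevel f t := fun w hw => by
    rw [ENNReal.ofReal_lt_iff_lt_toReal ht ENNReal.coe_ne_top] at hw
    exact hw.le
  rw [lt_min_iff] at h
  exact Set.sub_mem_sub (aux x h.1) (aux y h.2)

theorem convex_superlevel {n : ℕ} {f : Euc n → ℝ≥0} (hf : QuasiconcaveOn ℝ Set.univ f) (t : ℝ) :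
    Convex ℝ (superlevel f t) := by
  have : superlevel f t = {x ∈ Set.univ | t.toNNReal ≤ f x} := by
    ext x
    simp [superlevel, Real.toNNReal_le_iff_le_coe]
  exact this ▸ hf t.toNNReal

theorem volume_superlevel_ne_top {n : ℕ} {f : Euc n → ℝ≥0}
    (hf : Integrable (fun x => (f x : ℝ)) (volume : Measure (Euc n))) {t : ℝ} (ht : 0 < t) :
    volume (superlevel f t) ≠ ∞ := by
  have := (hf.measure_ge_lt_top ht).ne
  exact this

/-- Stated for any `F` below the min-difference so that it serves both differences. -/
theorem lintegral_le_of_le_minDifference {n : ℕ} {φ : Euc n → ℝ≥0} (hφ : RadiallyDecreasing φ)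
    {f : Euc n → ℝ≥0} (hf : Integrable (fun x => (f x : ℝ)) (volume : Measure (Euc n)))
    (hq : QuasiconcaveOn ℝ Set.univ f) {F : Euc n → ℝ≥0∞}
    (hF : AEMeasurable F (volume : Measure (Euc n))) (hle : ∀ z, F z ≤ minDifference f z) :
    ∫⁻ z, F z ∂(densityMeasure φ) ≤
      ((2 * n).choose n : ℝ≥0∞) * ∫⁻ t in Set.Ioi (0 : ℝ),
        min (translatedAverage (densityMeasure φ) (superlevel f t))
          (translatedAverage (densityMeasure φ) (-superlevel f t)) := by
  have : SFinite (densityMeasure φ) := by unfold densityMeasure; infer_instance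
  rw [lintegral_eq_lintegral_measure_lt _
    (hF.mono_ac (densityMeasure_absolutelyContinuous φ)),
    ← lintegral_const_mul' _ _ (ENNReal.natCast_ne_top _)]
  refine setLIntegral_mono' measurableSet_Ioi fun t ht => ?_
  have ht : 0 < t := ht
  have hfin := volume_superlevel_ne_top hf ht
  have hconv := convex_superlevel hq t
  have hsub : densityMeasure φ {z | ENNReal.ofReal t < F z} ≤
      densityMeasure φ (superlevel f t - superlevel f t) :=
    measure_mono (subset_trans (fun z hz => lt_of_lt_of_le hz (hle z))
      (setOf_lt_minDifference_subset f ht.le))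
  refine hsub.trans ?_
  rcases min_cases (translatedAverage (densityMeasure φ) (superlevel f t))
    (translatedAverage (densityMeasure φ) (-superlevel f t)) with h | h <;> rw [h.1]
  · exact densityMeasure_sub_le hφ hconv hfin
  -- The difference body is unchanged under `K ↦ -K`, hence the minimum in the bound.
  · have hneg : superlevel f t - superlevel f t = -superlevel f t - -superlevel f t := by
      rw [sub_neg_eq_add, neg_add_eq_sub]
    rw [hneg]
    exact densityMeasure_sub_le hφ hconv.neg (by rwa [Measure.measure_neg])

theorem densityMeasure_one {n : ℕ} : densityMeasure (1 : Euc n → ℝ≥0) = volume := by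
  simp [densityMeasure]

theorem translatedAverage_volume_le {n : ℕ} (K : Set (Euc n)) :
    translatedAverage (volume : Measure (Euc n)) K ≤ volume K := by
  simp only [translatedAverage, measure_vadd, lintegral_const, Measure.restrict_apply_univ]
  rw [← mul_assoc]
  exact mul_le_of_le_one_left zero_le (ENNReal.inv_mul_le_one _)

theorem lintegral_volume_le_of_le_minDifference {n : ℕ}
    {f : Euc n → ℝ≥0} (hf : Integrable (fun x => (f x : ℝ)) (volume : Measure (Euc n)))
    (hq : QuasiconcaveOn ℝ Set.univ f) {F : Euc n → ℝ≥0∞}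
    (hF : AEMeasurable F (volume : Measure (Euc n))) (hle : ∀ z, F z ≤ minDifference f z) :
    ∫⁻ z, F z ≤ ((2 * n).choose n : ℝ≥0∞) * ∫⁻ x, (f x : ℝ≥0∞) := by
  have h := lintegral_le_of_le_minDifference (φ := 1) (fun _ _ _ => le_rfl) hf hq hF hle
  rw [densityMeasure_one] at h
  refine h.trans (mul_le_mul_right ?_ _)
  have hlc := lintegral_eq_lintegral_meas_le (volume : Measure (Euc n))
    (.of_forall fun x => (f x).coe_nonneg) hf.aemeasurable
  simp only [ENNReal.ofReal_coe_nnreal] at hlc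
  rw [hlc]
  exact lintegral_mono fun t => (min_le_left _ _).trans (translatedAverage_volume_le _)

theorem convex_setOf_lt_minDifference {n : ℕ} {f : Euc n → ℝ≥0}
    (hq : QuasiconcaveOn ℝ Set.univ f) (c : ℝ≥0∞) : Convex ℝ {z | c < minDifference f z} := by
  intro z₁ h₁ z₂ h₂ a b ha hb hab
  simp only [Set.mem_ofPred_eq, minDifference, lt_iSup_iff] at h₁ h₂ ⊢
  obtain ⟨x₁, y₁, rfl, h₁⟩ := h₁
  obtain ⟨x₂, y₂, rfl, h₂⟩ := h₂
  have key : ∀ u v : Euc n, c < f u → c < f v → c < f (a • u + b • v) := fun u v hu hv => by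
    have := (quasiconcaveOn_iff_min_le.1 hq).2 (Set.mem_univ u) (Set.mem_univ v) ha hb hab
    refine lt_of_lt_of_le (lt_min hu hv) ?_
    exact_mod_cast this
  rw [lt_min_iff] at h₁ h₂
  exact ⟨a • x₁ + b • x₂, a • y₁ + b • y₂, by module,
    lt_min (key _ _ h₁.1 h₂.1) (key _ _ h₁.2 h₂.2)⟩

/-! ### Functions that are `p`-concave with `p < 0` -/

theorem ENNReal.rpow_le_rpow_of_neg {q : ℝ} (hq : q < 0) {x y : ℝ≥0∞} (h : x ≤ y) :
    y ^ q ≤ x ^ q := by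
  rw [← neg_neg q, ENNReal.rpow_neg, ENNReal.rpow_neg x, ENNReal.inv_le_inv]
  exact ENNReal.rpow_le_rpow h (by linarith)

/-- Dropping one summand of `f(x)^p + f(y)^p` can only increase the `1/p`-th power, since `1/p < 0`.
-/
theorem pDifference_le_minDifference {n : ℕ} {p : ℝ} (hp : p < 0) (f : Euc n → ℝ≥0) (z : Euc n) :
    pDifference p f z ≤ minDifference f z := by
  have key : ∀ a s : ℝ≥0∞, a ^ p ≤ s → s ^ (1 / p) ≤ a := fun a s h => by
    have := ENNReal.rpow_le_rpow_of_neg (one_div_neg.2 hp) h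
    rwa [← ENNReal.rpow_mul, mul_one_div_cancel hp.ne, ENNReal.rpow_one] at this
  exact iSup_mono fun x => iSup_mono fun y => iSup_mono fun _ =>
    le_min (key _ _ le_self_add) (key _ _ le_add_self)

/-- Convexity of `f ^ p` in `[0, ∞]`: the convention `0 ^ p = ∞` absorbs the zeros of `f`. -/
theorem IsPConcave.rpow_le {n : ℕ} {p : ℝ} (hp : p < 0) {f : Euc n → ℝ≥0} (hf : IsPConcave p f)
    (x y : Euc n) {a b : ℝ} (ha : 0 ≤ a) (hb : 0 ≤ b) (hab : a + b = 1) :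
    (f (a • x + b • y) : ℝ≥0∞) ^ p ≤
      ENNReal.ofReal a * (f x : ℝ≥0∞) ^ p + ENNReal.ofReal b * (f y : ℝ≥0∞) ^ p := by
  rcases ha.eq_or_lt with rfl | ha
  · obtain rfl : b = 1 := by linarith
    simp
  rcases hb.eq_or_lt with rfl | hb
  · obtain rfl : a = 1 := by linarith
    simp
  rcases eq_or_ne (f x) 0 with hx | hx
  · simp [hx, ENNReal.zero_rpow_of_neg hp, ENNReal.mul_top, ha]
  rcases eq_or_ne (f y) 0 with hy | hy
  · simp [hy, ENNReal.zero_rpow_of_neg hp, ENNReal.mul_top, hb]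
  have hx' : (0 : ℝ) < f x := by exact_mod_cast pos_iff_ne_zero.2 hx
  have hy' : (0 : ℝ) < f y := by exact_mod_cast pos_iff_ne_zero.2 hy
  have h := hf x y b ⟨hb, by linarith⟩
  rw [pMean, if_neg (mul_pos hx' hy').ne', if_neg hp.ne, show 1 - b = a by linarith] at h
  have hs : 0 < a * (f x : ℝ) ^ p + b * (f y : ℝ) ^ p := by positivity
  have hr := Real.rpow_le_rpow_of_nonpos (Real.rpow_pos_of_pos hs _) h hp.le
  rw [← Real.rpow_mul hs.le, one_div_mul_cancel hp.ne, Real.rpow_one] at hr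
  have hz : (0 : ℝ) < f (a • x + b • y) := (Real.rpow_pos_of_pos hs _).trans_le h
  have conv : ∀ w : ℝ≥0, (0 : ℝ) < w → (w : ℝ≥0∞) ^ p = ENNReal.ofReal ((w : ℝ) ^ p) := fun w hw => by
    rw [← ENNReal.ofReal_rpow_of_pos hw, ENNReal.ofReal_coe_nnreal]
  rw [conv _ hx', conv _ hy', conv _ hz, ← ENNReal.ofReal_mul ha.le, ← ENNReal.ofReal_mul hb.le,
    ← ENNReal.ofReal_add (by positivity) (by positivity)]
  exact ENNReal.ofReal_le_ofReal hr

theorem ENNReal.ofReal_mul_add_ofReal_mul_le_max {a b : ℝ} (ha : 0 ≤ a) (hb : 0 ≤ b)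
    (hab : a + b = 1) (s t : ℝ≥0∞) :
    ENNReal.ofReal a * s + ENNReal.ofReal b * t ≤ max s t := by
  calc ENNReal.ofReal a * s + ENNReal.ofReal b * t
      ≤ ENNReal.ofReal a * max s t + ENNReal.ofReal b * max s t := by
        gcongr
        exacts [le_max_left _ _, le_max_right _ _]
    _ = max s t := by rw [← add_mul, ← ENNReal.ofReal_add ha hb, hab, ENNReal.ofReal_one, one_mul]

theorem IsPConcave.quasiconcaveOn {n : ℕ} {p : ℝ} (hp : p < 0) {f : Euc n → ℝ≥0}
    (hf : IsPConcave p f) : QuasiconcaveOn ℝ Set.univ f := by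
  refine quasiconcaveOn_iff_min_le.2 ⟨convex_univ, fun x _ y _ a b ha hb hab => ?_⟩
  have h := ENNReal.rpow_le_rpow_of_neg (one_div_neg.2 hp)
    ((hf.rpow_le hp x y ha hb hab).trans (ENNReal.ofReal_mul_add_ofReal_mul_le_max ha hb hab _ _))
  have e : ∀ w : ℝ≥0∞, (w ^ p) ^ (1 / p) = w := fun w => by
    rw [← ENNReal.rpow_mul, mul_one_div_cancel hp.ne, ENNReal.rpow_one]
  rw [e] at h
  rcases max_choice ((f x : ℝ≥0∞) ^ p) ((f y : ℝ≥0∞) ^ p) with hm | hm <;> rw [hm, e] at h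
  · exact (min_le_left _ _).trans (by exact_mod_cast h)
  · exact (min_le_right _ _).trans (by exact_mod_cast h)

/-- `(x, y) ↦ f(x)^p + f(y)^p` is jointly convex, so a convex combination of two representations `z
= x - y` has value at most the larger of the two sums. -/
theorem convex_setOf_lt_pDifference {n : ℕ} {p : ℝ} (hp : p < 0) {f : Euc n → ℝ≥0}
    (hf : IsPConcave p f) (c : ℝ≥0∞) : Convex ℝ {z | c < pDifference p f z} := by
  intro z₁ h₁ z₂ h₂ a b ha hb hab
  simp only [Set.mem_ofPred_eq, pDifference, lt_iSup_iff] at h₁ h₂ ⊢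
  obtain ⟨x₁, y₁, rfl, h₁⟩ := h₁
  obtain ⟨x₂, y₂, rfl, h₂⟩ := h₂
  refine ⟨a • x₁ + b • x₂, a • y₁ + b • y₂, by module, ?_⟩
  have hs := (add_le_add (hf.rpow_le hp x₁ x₂ ha hb hab) (hf.rpow_le hp y₁ y₂ ha hb hab)).trans
    (le_of_eq (by ring)) |>.trans (ENNReal.ofReal_mul_add_ofReal_mul_le_max ha hb hab
      ((f x₁ : ℝ≥0∞) ^ p + (f y₁ : ℝ≥0∞) ^ p) ((f x₂ : ℝ≥0∞) ^ p + (f y₂ : ℝ≥0∞) ^ p))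
  refine lt_of_lt_of_le ?_ (ENNReal.rpow_le_rpow_of_neg (one_div_neg.2 hp) hs)
  rcases max_choice ((f x₁ : ℝ≥0∞) ^ p + (f y₁ : ℝ≥0∞) ^ p)
    ((f x₂ : ℝ≥0∞) ^ p + (f y₂ : ℝ≥0∞) ^ p) with hm | hm <;> rwa [hm]

theorem theoremt (n : ℕ) (φ : Euc n → ℝ≥0) (hφm : AEMeasurable φ (volume : Measure (Euc n)))
    (hφ : RadiallyDecreasing φ) (f : Euc n → ℝ≥0)
    (hf : Integrable (fun x => (f x : ℝ)) (volume : Measure (Euc n))) :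
    (QuasiconcaveOn ℝ Set.univ f →
      AEMeasurable (minDifference f) (volume : Measure (Euc n)) ∧
      ∫⁻ z, minDifference f z ∂(densityMeasure φ) ≤
        ((2 * n).choose n : ℝ≥0∞) * ∫⁻ t in Set.Ioi (0 : ℝ),
          min (translatedAverage (densityMeasure φ) (superlevel f t))
            (translatedAverage (densityMeasure φ) (-superlevel f t)) ∧
      ∫⁻ z, minDifference f z ≤ ((2 * n).choose n : ℝ≥0∞) * ∫⁻ x, (f x : ℝ≥0∞)) ∧
    (∀ p : ℝ, p < 0 → IsPConcave p f →
      AEMeasurable (pDifference p f) (volume : Measure (Euc n)) ∧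
      ∫⁻ z, pDifference p f z ∂(densityMeasure φ) ≤
        ((2 * n).choose n : ℝ≥0∞) * ∫⁻ t in Set.Ioi (0 : ℝ),
          min (translatedAverage (densityMeasure φ) (superlevel f t))
            (translatedAverage (densityMeasure φ) (-superlevel f t)) ∧
      ∫⁻ z, pDifference p f z ≤ ((2 * n).choose n : ℝ≥0∞) * ∫⁻ x, (f x : ℝ≥0∞)) := by
  constructor
  · intro hq
    have hm := aemeasurable_of_convex_lt (convex_setOf_lt_minDifference hq)
    exact ⟨hm, lintegral_le_of_le_minDifference hφ hf hq hm fun _ => le_rfl,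
      lintegral_volume_le_of_le_minDifference hf hq hm fun _ => le_rfl⟩
  · intro p hp hpf
    have hq := hpf.quasiconcaveOn hp
    have hm := aemeasurable_of_convex_lt (convex_setOf_lt_pDifference hp hpf)
    have hle := pDifference_le_minDifference hp f
    exact ⟨hm, lintegral_le_of_le_minDifference hφ hf hq hm hle,
      lintegral_volume_le_of_le_minDifference hf hq hm hle⟩
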